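/- Conventions. All vector spaces are over $\mathbf{C}$, and $(\mathrm{fs})$ denotes the category of finite sets and bijections. A twisted commutative algebra is a functor $A\colon(\mathrm{fs})\to\mathrm{Vec}_{\mathbf{C}}$, $L\mapsto A_L$, together with a unit element $1\in A_\emptyset$ and multiplication maps $A_L\otimes A_{L'}\to A_{L\amalg L'}$, natural in $L$ and $L'$, which are associative, commutative and unital up to the canonical bijections of finite sets. An $A$-module is a functor $M\colon(\mathrm{fs})\to\mathrm{Vec}_{\mathbf{C}}$ with natural maps $A_L\otimes M_{L'}\to M_{L\amalg L'}$ satisfying the associativity and unit axioms. An element of $A$ or $M$ is an element of $A_L$ or $M_L$ for some finite set $L$, and its order is $\#L$. The algebra $A$ is finitely generated in order $1$ if there are finitely many elements of $A$ of order $1$ such that $A$ is the only subalgebra (subfunctor containing $1$ and closed under multiplication) containing them. The module $M$ is finitely generated if there are finitely many elements of $M$ (of any orders) such that $M$ is the only $A$-submodule containing them. Write $M_n=M_{\{1,\dots,n\}}$. Theorem. Let $A$ be a twisted commutative algebra finitely generated in order $1$, and let $M$ be a finitely generated $A$-module. Then every $M_n$ is finite dimensional, and the following two (equivalent) statements hold.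 (a) The exponential Hilbert series $$H_M(t)=\sum_{n\ge 0}\frac{\dim(M_n)}{n!}\,t^n\in\mathbf{Q}[[t]]$$ is a polynomial in $t$ and $e^t$: there is $P\in\mathbf{Q}[x,y]$ with $H_M(t)=P(t,e^t)$. (b) There are an integer $d\ge 0$, polynomials $p_0,\dots,p_d\in\mathbf{Q}[t]$ and non-negative integers $a_0,\dots,a_d$ such that $$H^*_M(t)=\sum_{n\ge 0}\dim(M_n)\,t^n=\sum_{k=0}^{d}\frac{p_k(t)}{(1-kt)^{a_k}}\quad\text{in }\mathbf{Q}[[t]].$$ -/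

import Mathlib

universe u v

/-- An object of `Sym(Vec)` in the standard model: a functor from the category of finite sets
and bijections to the category of complex vector spaces. -/
structure LinearSpecies where
  obj : (L : Type) → [Finite L] → Type u
  [instAddCommGroup : (L : Type) → [Finite L] → AddCommGroup (obj L)]
  [instModule : (L : Type) → [Finite L] → Module ℂ (obj L)]
  map : {L L' : Type} → [Finite L] → [Finite L'] → (L ≃ L') → obj L →ₗ[ℂ] obj L'
  map_refl : ∀ (L : Type) [Finite L] (x : obj L), map (Equiv.refl L) x = x
  map_trans : ∀ {L L' L'' : Type} [Finite L] [Finite L'] [Finite L'']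
    (e : L ≃ L') (f : L' ≃ L'') (x : obj L), map (e.trans f) x = map f (map e x)

attribute [instance] LinearSpecies.instAddCommGroup LinearSpecies.instModule

/-- A twisted commutative algebra in the standard model: a functor `A` from finite sets and
bijections to complex vector spaces, with a unit in `A_∅` and a natural multiplication
`A_L ⊗ A_{L'} → A_{L ⨿ L'}` which is associative, commutative and unital up to the canonical
bijections of finite sets. -/
structure TwistedCommAlgebra extends LinearSpecies.{u} where
  one : obj Empty
  mul : {L L' : Type} → [Finite L] → [Finite L'] → obj L →ₗ[ℂ] obj L' →ₗ[ℂ] obj (L ⊕ L')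
  map_mul : ∀ {L L' K K' : Type} [Finite L] [Finite L'] [Finite K] [Finite K']
    (e : L ≃ K) (f : L' ≃ K') (a : obj L) (b : obj L'),
    map (Equiv.sumCongr e f) (mul a b) = mul (map e a) (map f b)
  mul_assoc : ∀ {L L' L'' : Type} [Finite L] [Finite L'] [Finite L'']
    (a : obj L) (b : obj L') (c : obj L''),
    map (Equiv.sumAssoc L L' L'') (mul (mul a b) c) = mul a (mul b c)
  mul_comm : ∀ {L L' : Type} [Finite L] [Finite L'] (a : obj L) (b : obj L'),
    map (Equiv.sumComm L L') (mul a b) = mul b a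
  one_mul : ∀ {L : Type} [Finite L] (a : obj L),
    map (Equiv.emptySum Empty L) (mul one a) = a

/-- A module over a twisted commutative algebra `A`: a functor `M` from finite sets and
bijections to complex vector spaces, with a natural action `A_L ⊗ M_{L'} → M_{L ⨿ L'}` which is
associative and unital. -/
structure TCModule (A : TwistedCommAlgebra.{u}) extends LinearSpecies.{v} where
  smul : {L L' : Type} → [Finite L] → [Finite L'] → A.obj L →ₗ[ℂ] obj L' →ₗ[ℂ] obj (L ⊕ L')
  map_smul : ∀ {L L' K K' : Type} [Finite L] [Finite L'] [Finite K] [Finite K']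
    (e : L ≃ K) (f : L' ≃ K') (a : A.obj L) (m : obj L'),
    map (Equiv.sumCongr e f) (smul a m) = smul (A.map e a) (map f m)
  mul_smul : ∀ {L L' L'' : Type} [Finite L] [Finite L'] [Finite L'']
    (a : A.obj L) (b : A.obj L') (m : obj L''),
    map (Equiv.sumAssoc L L' L'') (smul (A.mul a b) m) = smul a (smul b m)
  one_smul : ∀ {L : Type} [Finite L] (m : obj L),
    map (Equiv.emptySum Empty L) (smul A.one m) = m

/-- A family of subspaces `W_L ⊆ V_L` is a subobject (subfunctor) of `V`. -/
def LinearSpecies.IsSubobject (V : LinearSpecies.{u})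
    (W : (L : Type) → [Finite L] → Submodule ℂ (V.obj L)) : Prop :=
  ∀ (L L' : Type) [Finite L] [Finite L'] (e : L ≃ L') (x : V.obj L),
    x ∈ W L → V.map e x ∈ W L'

/-- A family of subspaces `W_L ⊆ A_L` is a (unital) subalgebra of `A`. -/
def TwistedCommAlgebra.IsSubalgebra (A : TwistedCommAlgebra.{u})
    (W : (L : Type) → [Finite L] → Submodule ℂ (A.obj L)) : Prop :=
  A.IsSubobject W ∧ A.one ∈ W Empty ∧
    ∀ (L L' : Type) [Finite L] [Finite L'] (a : A.obj L) (b : A.obj L'),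
      a ∈ W L → b ∈ W L' → A.mul a b ∈ W (L ⊕ L')

/-- A family of subspaces `W_L ⊆ M_L` is an `A`-submodule of `M`. -/
def TCModule.IsSubmodule {A : TwistedCommAlgebra.{u}} (M : TCModule.{u, v} A)
    (W : (L : Type) → [Finite L] → Submodule ℂ (M.obj L)) : Prop :=
  M.IsSubobject W ∧
    ∀ (L L' : Type) [Finite L] [Finite L'] (a : A.obj L) (m : M.obj L'),
      m ∈ W L' → M.smul a m ∈ W (L ⊕ L')

/-- `A` is finitely generated in order 1: there are finitely many elements `x i ∈ A_{L i}` of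
order `#(L i) = 1` such that the only subalgebra of `A` containing them is `A` itself. -/
def TwistedCommAlgebra.FinitelyGeneratedInOrderOne (A : TwistedCommAlgebra.{u}) : Prop :=
  ∃ (r : ℕ) (L : Fin r → Type) (_ : ∀ i, Finite (L i)) (x : (i : Fin r) → A.obj (L i)),
    (∀ i, Nat.card (L i) = 1) ∧
    ∀ W : (K : Type) → [Finite K] → Submodule ℂ (A.obj K),
      A.IsSubalgebra W → (∀ i, x i ∈ W (L i)) → ∀ (K : Type) [Finite K], W K = ⊤

/-- `M` is finitely generated: there are finitely many elements `x i ∈ M_{L i}` (of arbitrary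
orders) such that the only `A`-submodule of `M` containing them is `M` itself. -/
def TCModule.FinitelyGenerated {A : TwistedCommAlgebra.{u}} (M : TCModule.{u, v} A) : Prop :=
  ∃ (r : ℕ) (L : Fin r → Type) (_ : ∀ i, Finite (L i)) (x : (i : Fin r) → M.obj (L i)),
    ∀ W : (K : Type) → [Finite K] → Submodule ℂ (M.obj K),
      M.IsSubmodule W → (∀ i, x i ∈ W (L i)) → ∀ (K : Type) [Finite K], W K = ⊤

/-- The exponential Hilbert series `∑ (dim V_n) tⁿ / n!`, where `V_n` is the value of `V` on the
`n`-element set `Fin n`. -/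
noncomputable def LinearSpecies.hilbertSeries (V : LinearSpecies.{u}) : PowerSeries ℚ :=
  PowerSeries.mk fun n => (Module.finrank ℂ (V.obj (Fin n)) : ℚ) / (n.factorial : ℚ)

/-- The ordinary Hilbert series `∑ (dim V_n) tⁿ`. -/
noncomputable def LinearSpecies.hilbertSeriesStar (V : LinearSpecies.{u}) : PowerSeries ℚ :=
  PowerSeries.mk fun n => (Module.finrank ℂ (V.obj (Fin n)) : ℚ)

/-!
Let `y_c`, for `c` in a finite set `C` of colours, generate `A` in order one, and let `x_i ∈ M_{L_i}`
generate `M`. Since `A` is commutative, `M_K` is spanned by monomials: a monomial is given by a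
generator `x_i`, an injection `L_i → K`, and a colour for every other point of `K`. For `K = Fin n`
this is a word of length `n` whose letters are colours and points of `L_i`, every point of `L_i`
occurring once (`IsMonomial`, `IsMonomial.unique`, `TCModule.span_isMonomial`).

Order the words of length `n` by generator and then lexicographically, and call a word standard if
its monomial is not a linear combination of smaller ones. Standard monomials form a basis of `M_n`,
so `dim M_n` counts standard words (`finrank_eq_sum_wordCount`). Inserting a colour at a fixed place
is a linear map on monomials and is strictly monotone on words, so the set of standard words is
closed under deleting colours (`deletionClosed_standardWords`).

It remains to count the words of a set `D` that is closed under deleting colours and whose words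
have boundedly many letters that are not colours. Splitting off the first letter `a` gives
`#D(n + 1) = ∑ₐ #Dₐ(n)` with `Dₐ = {w | a w ∈ D}`. For a colour `a`, `Dₐ ⊆ D`; for another letter the
bound on the number of such letters drops. If `k` is the number of letters with `Dₐ = D`, then
`#D(n + 1) = k #D(n) + g(n)`, where `g` comes from sets that are smaller in a well-founded sense:
Higman's lemma gives the descending chain condition (`wellFounded_deletionClosed`). By induction
`#D` lies in every space of sequences stable under solving such recurrences (`wordCount_mem`).

Two such spaces give the theorem. For exponential generating functions the recurrence reads
`F' = k F + G`, which is solvable among polynomials in `X` and `e^X` (`expPolySeq_of_recurrence`).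
For ordinary ones it reads `(1 - k X) F = f(0) + X G`, and partial fractions show that the span of
the `X^i / (1 - k X)^a` contains the solution (`ratSeq_of_recurrence`).
-/

/-! ### Monomials in a module over a twisted commutative algebra -/

section ActionLemmas

variable {A : TwistedCommAlgebra.{u}} (M : TCModule.{u, v} A)

theorem LinearSpecies.map_map (V : LinearSpecies.{v}) {L L' L'' : Type} [Finite L] [Finite L']
    [Finite L''] (e : L ≃ L') (f : L' ≃ L'') (x : V.obj L) :
    V.map f (V.map e x) = V.map (e.trans f) x :=
  (V.map_trans e f x).symm

theorem TCModule.smul_map {L L' K' : Type} [Finite L] [Finite L'] [Finite K']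
    (f : L' ≃ K') (a : A.obj L) (m : M.obj L') :
    M.smul a (M.map f m) = M.map (Equiv.sumCongr (Equiv.refl L) f) (M.smul a m) := by
  rw [M.map_smul, A.map_refl]

theorem TCModule.map_smul_left {L L' K : Type} [Finite L] [Finite L'] [Finite K]
    (e : L ≃ K) (a : A.obj L) (m : M.obj L') :
    M.smul (A.map e a) m = M.map (Equiv.sumCongr e (Equiv.refl L')) (M.smul a m) := by
  rw [M.map_smul, M.map_refl]

/-- The canonical bijection exchanging the first two of three summands. -/
def sumLeftComm (L L' L'' : Type) : L ⊕ (L' ⊕ L'') ≃ L' ⊕ (L ⊕ L'') :=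
  ((Equiv.sumAssoc L L' L'').symm.trans
    (Equiv.sumCongr (Equiv.sumComm L L') (Equiv.refl L''))).trans (Equiv.sumAssoc L' L L'')

theorem TCModule.smul_left_comm {L L' L'' : Type} [Finite L] [Finite L'] [Finite L'']
    (a : A.obj L) (b : A.obj L') (m : M.obj L'') :
    M.map (sumLeftComm L L' L'') (M.smul a (M.smul b m)) = M.smul b (M.smul a m) := by
  rw [← M.mul_smul b a m, ← A.mul_comm a b, M.map_smul_left, ← M.mul_smul a b m]
  simp only [LinearSpecies.map_map]
  congr 2
  ext ((_ | _) | _) <;> rfl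

end ActionLemmas

/-- `IsMonomial M y ι x K w m` says that `m ∈ M_K` is a monomial multiple of the generator
`x ∈ M_L` by the order-one elements `y c`, and that the word `w` on `K` records it: a point of `K`
is labelled by the colour `c` if it carries a factor `y c`, and by `ι l` if it is the point
`l ∈ L` of the generator. -/
inductive IsMonomial {A : TwistedCommAlgebra.{u}} (M : TCModule.{u, v} A) {C S L : Type}
    [Finite L] (y : C → A.obj Unit) (ι : L → S) (x : M.obj L) :
    (K : Type) → [Finite K] → (K → C ⊕ S) → M.obj K → Prop
  | gen : IsMonomial M y ι x L (fun l => Sum.inr (ι l)) x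
  | smul (c : C) {K : Type} [Finite K] {w : K → C ⊕ S} {m : M.obj K}
      (h : IsMonomial M y ι x K w m) :
      IsMonomial M y ι x (Unit ⊕ K) (Sum.elim (fun _ => Sum.inl c) w) (M.smul (y c) m)
  | map {K K' : Type} [Finite K] [Finite K'] (e : K ≃ K') {w : K → C ⊕ S} {m : M.obj K}
      (h : IsMonomial M y ι x K w m) : IsMonomial M y ι x K' (w ∘ e.symm) (M.map e m)

/-- A bijection `Unit ⊕ K ≃ Unit ⊕ K'` fixing the extra point comes from a bijection `K ≃ K'`. -/
theorem exists_sumCongr_refl_eq {K K' : Type} (e : Unit ⊕ K ≃ Unit ⊕ K')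
    (he : e (Sum.inl ()) = Sum.inl ()) :
    ∃ f : K ≃ K', e = Equiv.sumCongr (Equiv.refl Unit) f := by
  have h1 : ∀ k : K, ∃ k' : K', e (Sum.inr k) = Sum.inr k' := fun k => by
    rcases h : e (Sum.inr k) with u | k'
    · exact absurd (e.injective (h.trans he.symm)) (by simp)
    · exact ⟨k', rfl⟩
  have h2 : ∀ k : K', ∃ k' : K, e.symm (Sum.inr k) = Sum.inr k' := fun k => by
    rcases h : e.symm (Sum.inr k) with u | k'
    · have := (e.symm_apply_eq).1 h
      exact absurd (this.trans he) (by simp)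
    · exact ⟨k', rfl⟩
  choose f hf using h1
  choose g hg using h2
  refine ⟨⟨f, g, fun k => ?_, fun k => ?_⟩, ?_⟩
  · have := hg (f k)
    rw [← hf k, Equiv.symm_apply_apply] at this
    exact (Sum.inr_injective this).symm
  · have := hf (g k)
    rw [← hg k, Equiv.apply_symm_apply] at this
    exact (Sum.inr_injective this).symm
  · ext a
    rcases a with u | k
    · simpa using he
    · simpa using hf k

namespace IsMonomial

variable {A : TwistedCommAlgebra.{u}} {M : TCModule.{u, v} A} {C S L : Type}
    [Finite L] {y : C → A.obj Unit} {ι : L → S} {x : M.obj L}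

theorem map_of_eq {K K' : Type} [Finite K] [Finite K'] (e : K ≃ K') {w : K → C ⊕ S}
    {w' : K' → C ⊕ S} {m : M.obj K} (h : IsMonomial M y ι x K w m) (hw : w = w' ∘ e) :
    IsMonomial M y ι x K' w' (M.map e m) := by
  have := h.map e
  rw [hw] at this
  simpa [Function.comp_assoc] using this

/-- The factor sitting at any coloured point of a monomial can be split off. -/
theorem exists_smul {K : Type} [Finite K] {w : K → C ⊕ S} {m : M.obj K}
    (h : IsMonomial M y ι x K w m) : ∀ (k : K) (c : C), w k = Sum.inl c →
      ∃ (K' : Type) (_ : Finite K') (e : Unit ⊕ K' ≃ K) (m' : M.obj K'),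
        e (Sum.inl ()) = k ∧ IsMonomial M y ι x K' (w ∘ e ∘ Sum.inr) m' ∧
        m = M.map e (M.smul (y c) m') := by
  induction h with
  | gen => intro k c hk; simp at hk
  | @smul d K _ w m h ih =>
    rintro (⟨⟨⟩⟩ | k) c hk
    · obtain rfl : d = c := by simpa using hk
      exact ⟨K, inferInstance, Equiv.refl _, m, rfl, h, (M.map_refl _ _).symm⟩
    · obtain ⟨K', hK', e, m', rfl, hm', rfl⟩ := ih k c hk
      refine ⟨Unit ⊕ K', inferInstance,
        (sumLeftComm Unit Unit K').trans (Equiv.sumCongr (Equiv.refl _) e),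
        M.smul (y d) m', rfl, ?_, ?_⟩
      · convert hm'.smul d using 1
        ext (_ | _) <;> rfl
      · rw [M.smul_map, ← M.map_map, M.smul_left_comm]
  | @map K K' _ _ f w m h ih =>
    intro k c hk
    obtain ⟨K', hK', e, m', he, hm', rfl⟩ := ih (f.symm k) c hk
    refine ⟨K', hK', e.trans f, m', by simp [he], ?_, ?_⟩
    · convert hm' using 1
      ext; simp
    · rw [M.map_map]

/-- Splitting off a factor along a prescribed bijection. -/
theorem exists_eq_map_smul {K K' : Type} [Finite K] [Finite K'] {w : K → C ⊕ S} {m : M.obj K}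
    (h : IsMonomial M y ι x K w m) (e : Unit ⊕ K' ≃ K) {c : C}
    (hc : w (e (Sum.inl ())) = Sum.inl c) :
    ∃ m' : M.obj K', IsMonomial M y ι x K' (w ∘ e ∘ Sum.inr) m' ∧
      m = M.map e (M.smul (y c) m') := by
  obtain ⟨K'', _, e', m', he', hm', rfl⟩ := h.exists_smul _ c hc
  obtain ⟨f, hf⟩ := exists_sumCongr_refl_eq (e'.trans e.symm) (by simp [he'])
  have hf' : e' = (Equiv.sumCongr (Equiv.refl Unit) f).trans e := by
    rw [← hf]; ext; simp
  refine ⟨M.map f m', hm'.map_of_eq f ?_, ?_⟩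
  · ext k; simp [hf']
  · rw [M.smul_map, M.map_map, hf']

/-- A monomial without coloured points is a transport of the generator itself. -/
theorem eq_map_of_forall_ne {K : Type} [Finite K] {w : K → C ⊕ S} {m : M.obj K}
    (h : IsMonomial M y ι x K w m) (hw : ∀ k c, w k ≠ Sum.inl c) :
    ∃ e : L ≃ K, (∀ l, w (e l) = Sum.inr (ι l)) ∧ m = M.map e x := by
  induction h with
  | gen => exact ⟨Equiv.refl _, fun _ => rfl, (M.map_refl _ _).symm⟩
  | @smul d K _ w m h ih => exact absurd rfl (hw (Sum.inl ()) d)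
  | @map K K' _ _ f w m h ih =>
    obtain ⟨e, he, rfl⟩ := ih fun k c hk => hw (f k) c (by simpa using hk)
    exact ⟨e.trans f, fun l => by simp [he], by rw [M.map_map]⟩

/-- A monomial is determined by its word; this is where the commutativity of `A` enters. -/
theorem unique (hι : Function.Injective ι) {K : Type} [Finite K] {w : K → C ⊕ S} {m : M.obj K}
    (h : IsMonomial M y ι x K w m) : ∀ m', IsMonomial M y ι x K w m' → m = m' := by
  induction h with
  | gen =>
    intro m' h'
    obtain ⟨e, he, rfl⟩ := h'.eq_map_of_forall_ne (by simp)
    obtain rfl : e = Equiv.refl L := by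
      ext l
      exact hι (by simpa using he l)
    rw [M.map_refl]
  | @smul d K _ w m h ih =>
    intro m' h'
    obtain ⟨m'', hm'', rfl⟩ := h'.exists_eq_map_smul (Equiv.refl _) (c := d) rfl
    rw [M.map_refl, ih m'' hm'']
  | @map K K' _ _ f w m h ih =>
    intro m' h'
    rw [ih (M.map f.symm m') (h'.map_of_eq f.symm rfl), M.map_map, Equiv.symm_trans_self,
      M.map_refl]

/-- The points carrying the generator have pairwise distinct labels. -/
theorem eq_of_label_eq (hι : Function.Injective ι) {K : Type} [Finite K] {w : K → C ⊕ S}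
    {m : M.obj K} (h : IsMonomial M y ι x K w m) :
    ∀ (k k' : K) (s : S), w k = Sum.inr s → w k' = Sum.inr s → k = k' := by
  induction h with
  | gen =>
    intro k k' s h h'
    exact hι (Sum.inr_injective (h.trans h'.symm))
  | @smul d K _ w m h ih =>
    rintro (k | k) (k' | k') s h h'
    · rfl
    · simp at h
    · simp at h'
    · rw [ih k k' s h h']
  | @map K K' _ _ f w m h ih =>
    intro k k' s h h'
    exact f.symm.injective (ih _ _ s h h')

end IsMonomial

/-- If the `y c` generate `A` and the `x i` generate `M`, the monomials span `M`. -/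
theorem TCModule.span_isMonomial {A : TwistedCommAlgebra.{u}} (M : TCModule.{u, v} A)
    {C S I : Type} {L : I → Type} [∀ i, Finite (L i)]
    (y : C → A.obj Unit) (ι : ∀ i, L i → S) (x : ∀ i, M.obj (L i))
    (hy : ∀ W : (K : Type) → [Finite K] → Submodule ℂ (A.obj K),
      A.IsSubalgebra W → (∀ c, y c ∈ W Unit) → ∀ (K : Type) [Finite K], W K = ⊤)
    (hx : ∀ W : (K : Type) → [Finite K] → Submodule ℂ (M.obj K),
      M.IsSubmodule W → (∀ i, x i ∈ W (L i)) → ∀ (K : Type) [Finite K], W K = ⊤)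
    (K : Type) [Finite K] :
    Submodule.span ℂ {m : M.obj K | ∃ i w, IsMonomial M y (ι i) (x i) K w m} = ⊤ := by
  set W : (K : Type) → [Finite K] → Submodule ℂ (M.obj K) := fun K _ =>
    Submodule.span ℂ {m : M.obj K | ∃ i w, IsMonomial M y (ι i) (x i) K w m} with hW
  have hmap : M.IsSubobject W := by
    intro K K' _ _ e m hm
    have : W K ≤ (W K').comap (M.map e) := by
      refine Submodule.span_le.2 ?_
      rintro m ⟨i, w, h⟩
      exact Submodule.subset_span ⟨i, _, h.map e⟩
    exact this hm
  -- The elements of `A` preserving `W` form a subalgebra containing the generators.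
  set B : (Q : Type) → [Finite Q] → Submodule ℂ (A.obj Q) := fun Q _ =>
    { carrier := {a | ∀ (K : Type) [Finite K] (m : M.obj K), m ∈ W K → M.smul a m ∈ W (Q ⊕ K)}
      add_mem' := fun {a b} ha hb K _ m hm => by
        rw [map_add, LinearMap.add_apply]
        exact add_mem (ha K m hm) (hb K m hm)
      zero_mem' := fun K _ m hm => by
        rw [map_zero, LinearMap.zero_apply]
        exact zero_mem _
      smul_mem' := fun r a ha K _ m hm => by
        rw [_root_.map_smul, LinearMap.smul_apply]
        exact Submodule.smul_mem _ _ (ha K m hm) } with hB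
  have hBtop : ∀ (Q : Type) [Finite Q], B Q = ⊤ := by
    refine hy B ⟨?_, ?_, ?_⟩ ?_
    · intro Q Q' _ _ e a ha K _ m hm
      rw [M.map_smul_left]
      exact hmap _ _ _ _ (ha K m hm)
    · intro K _ m hm
      have h1 := hmap _ _ (Equiv.emptySum Empty K).symm _ hm
      rw [← M.one_smul m, M.map_map, Equiv.self_trans_symm, M.map_refl] at h1
      exact h1
    · intro Q Q' _ _ a b ha hb K _ m hm
      have h1 := hmap _ _ (Equiv.sumAssoc Q Q' K).symm _ (ha _ _ (hb _ _ hm))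
      rw [← M.mul_smul, M.map_map, Equiv.self_trans_symm, M.map_refl] at h1
      exact h1
    · intro c K _ m hm
      have : W K ≤ (W (Unit ⊕ K)).comap (M.smul (y c)) := by
        refine Submodule.span_le.2 ?_
        rintro m ⟨i, w, h⟩
        exact Submodule.subset_span ⟨i, _, h.smul c⟩
      exact this hm
  refine hx W ⟨hmap, ?_⟩ ?_ K
  · intro Q K _ _ a m hm
    have : a ∈ B Q := by rw [hBtop]; trivial
    exact this K m hm
  · intro i
    exact Submodule.subset_span ⟨i, _, IsMonomial.gen⟩

/-! ### Two spaces of sequences stable under linear recurrences -/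

section Series

open PowerSeries

/-- The power series that are polynomials in `X` and `e^X`. -/
noncomputable abbrev expPolyRing : Subalgebra ℚ (PowerSeries ℚ) := Algebra.adjoin ℚ {X, exp ℚ}

/-- The power series `1 / (1 - k X)`. -/
noncomputable def geomSeries (k : ℕ) : PowerSeries ℚ := (1 - C (k : ℚ) * X)⁻¹

/-- The span of the power series `X^i / (1 - k X)^a`. -/
noncomputable abbrev ratSeries : Submodule ℚ (PowerSeries ℚ) :=
  Submodule.span ℚ {F | ∃ i k a : ℕ, F = X ^ i * geomSeries k ^ a}

/-- Sequences whose exponential generating function is a polynomial in `X` and `e^X`. -/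
noncomputable def expPolySeq : Submodule ℚ (ℕ → ℚ) :=
  expPolyRing.toSubmodule.comap (σ₁₂ := RingHom.id ℚ)
    { toFun := fun f => mk (fun n => f n / (n.factorial : ℚ))
      map_add' := fun f g => by ext; simp [add_div]
      map_smul' := fun r f => by ext; simp [mul_div_assoc] }

/-- Sequences whose generating function is a combination of the series `X^i / (1 - k X)^a`. -/
noncomputable def ratSeq : Submodule ℚ (ℕ → ℚ) :=
  ratSeries.comap (σ₁₂ := RingHom.id ℚ)
    { toFun := fun f => mk f
      map_add' := fun _ _ => rfl
      map_smul' := fun r f => by ext; simp }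

theorem adjoin_X_exp_induction {p : PowerSeries ℚ → Prop}
    (hadd : ∀ F G, p F → p G → p (F + G))
    (hsmul : ∀ (r : ℚ) F, p F → p (r • F)) (h : ∀ i j : ℕ, p (X ^ i * exp ℚ ^ j))
    {F : PowerSeries ℚ} (hF : F ∈ expPolyRing) : p F := by
  rw [← Subalgebra.mem_toSubmodule, Algebra.adjoin_eq_span] at hF
  induction hF using Submodule.span_induction with
  | mem z hz =>
    obtain ⟨i, j, rfl⟩ := (Submonoid.mem_closure_pair _ _ _).1 hz
    exact h i j
  | zero => simpa using hsmul 0 _ (h 0 0)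
  | add F G _ _ hF hG => exact hadd F G hF hG
  | smul r F _ hF => exact hsmul r F hF

theorem derivative_exp_pow (k : ℕ) : d⁄dX ℚ (exp ℚ ^ k) = (k : ℚ) • exp ℚ ^ k := by
  rcases k with _ | k
  · simp
  · rw [derivative_pow, derivative_exp, Nat.add_sub_cancel, pow_succ, smul_eq_C_mul, map_natCast]
    push_cast
    ring

/-- The equation `H' - k H = G` has a solution among the polynomials in `X` and `e^X` whenever
`G` is one. -/
theorem exists_derivative_sub_smul_eq (k : ℕ) {G : PowerSeries ℚ}
    (hG : G ∈ expPolyRing) :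
    ∃ H ∈ expPolyRing, d⁄dX ℚ H - (k : ℚ) • H = G := by
  have hX : (X : PowerSeries ℚ) ∈ expPolyRing :=
    Algebra.subset_adjoin (by simp)
  have hE : exp ℚ ∈ expPolyRing :=
    Algebra.subset_adjoin (by simp)
  refine adjoin_X_exp_induction
    (p := fun G => ∃ H ∈ expPolyRing, d⁄dX ℚ H - (k : ℚ) • H = G) ?_ ?_ ?_ hG
  · rintro _ _ ⟨H₁, h₁, rfl⟩ ⟨H₂, h₂, rfl⟩
    exact ⟨H₁ + H₂, add_mem h₁ h₂, by rw [map_add, smul_add]; ring⟩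
  · rintro r _ ⟨H, h, rfl⟩
    refine ⟨r • H, Subalgebra.smul_mem _ h r, ?_⟩
    rw [Derivation.map_smul, smul_sub, smul_comm r]
  · intro i j
    have key : ∀ n : ℕ, d⁄dX ℚ ((X : PowerSeries ℚ) ^ n * exp ℚ ^ j)
        = (n : ℚ) • (X ^ (n - 1) * exp ℚ ^ j) + (j : ℚ) • (X ^ n * exp ℚ ^ j) := fun n => by
      rw [Derivation.leibniz, derivative_exp_pow, derivative_pow, derivative_X]
      simp only [smul_eq_mul, smul_eq_C_mul, map_natCast]
      ring
    by_cases hjk : j = k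
    -- Resonance: the power of `X` has to be raised.
    · subst hjk
      refine ⟨((i : ℚ) + 1)⁻¹ • (X ^ (i + 1) * exp ℚ ^ j),
        Subalgebra.smul_mem _ (mul_mem (pow_mem hX _) (pow_mem hE _)) _, ?_⟩
      have hi : (i : ℚ) + 1 ≠ 0 := by positivity
      rw [Derivation.map_smul, key, smul_add, smul_smul, Nat.add_sub_cancel,
        smul_comm (((i : ℚ) + 1)⁻¹) (j : ℚ), add_sub_cancel_right]
      push_cast
      rw [inv_mul_cancel₀ hi, one_smul]
    -- Otherwise the error term of `X ^ i * e ^ (j X) / (j - k)` has a lower power of `X`.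
    · have hjk' : (j : ℚ) - k ≠ 0 := sub_ne_zero.2 (by exact_mod_cast hjk)
      induction i with
      | zero =>
        refine ⟨((j : ℚ) - k)⁻¹ • (X ^ 0 * exp ℚ ^ j),
          Subalgebra.smul_mem _ (mul_mem (pow_mem hX _) (pow_mem hE _)) _, ?_⟩
        rw [Derivation.map_smul, key, smul_comm (k : ℚ), ← smul_sub, Nat.cast_zero, zero_smul,
          zero_add, ← sub_smul, smul_smul, inv_mul_cancel₀ hjk', one_smul]
      | succ i ih =>
        obtain ⟨H, hH, hH'⟩ := ih
        refine ⟨((j : ℚ) - k)⁻¹ • (X ^ (i + 1) * exp ℚ ^ j - ((i : ℚ) + 1) • H),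
          Subalgebra.smul_mem _ (sub_mem (mul_mem (pow_mem hX _) (pow_mem hE _))
            (Subalgebra.smul_mem _ hH _)) _, ?_⟩
        rw [sub_eq_iff_eq_add] at hH'
        rw [Derivation.map_smul, smul_comm (k : ℚ), ← smul_sub, inv_smul_eq_iff₀ hjk', map_sub,
          Derivation.map_smul, key, hH', Nat.add_sub_cancel]
        push_cast
        module

/-- Solutions of `F' = k F` are determined by their constant coefficient. -/
theorem eq_of_derivative_eq_smul {k : ℚ} {F G : PowerSeries ℚ} (hF : d⁄dX ℚ F = k • F)
    (hG : d⁄dX ℚ G = k • G) (h : coeff 0 F = coeff 0 G) : F = G := by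
  ext n
  induction n with
  | zero => exact h
  | succ n ih =>
    have h1 := congrArg (coeff n) hF
    have h2 := congrArg (coeff n) hG
    rw [coeff_derivative, map_smul, smul_eq_mul] at h1 h2
    have hn : (n : ℚ) + 1 ≠ 0 := by positivity
    exact mul_right_cancel₀ hn (by rw [h1, h2, ih])

theorem expPolySeq_of_recurrence {f g : ℕ → ℚ} (k : ℕ) (h : ∀ n, f (n + 1) = k * f n + g n)
    (hg : g ∈ expPolySeq) : f ∈ expPolySeq := by
  have hg' : mk (fun n => g n / (n.factorial : ℚ)) ∈ expPolyRing := hg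
  obtain ⟨H, hH, hH'⟩ := exists_derivative_sub_smul_eq k hg'
  set F : PowerSeries ℚ := mk fun n => f n / (n.factorial : ℚ) with hF
  have hF' : d⁄dX ℚ F = (k : ℚ) • F + mk fun n => g n / (n.factorial : ℚ) := by
    ext n
    have hn : (n : ℚ) + 1 ≠ 0 := by positivity
    have hn' : (n.factorial : ℚ) ≠ 0 := by positivity
    simp only [hF, coeff_derivative, coeff_mk, map_add, map_smul, smul_eq_mul, h,
      Nat.factorial_succ]
    push_cast
    field_simp
  -- `F - H` solves the homogeneous equation.
  have hsub : F - H = coeff 0 (F - H) • exp ℚ ^ k := by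
    refine eq_of_derivative_eq_smul (k := k) ?_ ?_ ?_
    · rw [map_sub, hF', ← hH']
      module
    · rw [Derivation.map_smul, derivative_exp_pow, smul_comm]
    · simp
  show F ∈ expPolyRing
  rw [← sub_add_cancel F H, hsub]
  exact add_mem (Subalgebra.smul_mem _ (pow_mem (Algebra.subset_adjoin (by simp)) _) _) hH

theorem one_sub_mul_geomSeries (k : ℕ) : (1 - C (k : ℚ) * X) * geomSeries k = 1 :=
  PowerSeries.mul_inv_cancel _ (by simp)

theorem inv_one_sub_pow (k a : ℕ) : ((1 - C (k : ℚ) * X) ^ a)⁻¹ = geomSeries k ^ a := by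
  rw [PowerSeries.inv_eq_iff_mul_eq_one (by simp), ← mul_pow, mul_comm, one_sub_mul_geomSeries,
    one_pow]

theorem geomSeries_mul_geomSeries {k l : ℕ} (h : k ≠ l) :
    geomSeries k * geomSeries l
      = ((k : ℚ) - l)⁻¹ • ((k : ℚ) • geomSeries k - (l : ℚ) • geomSeries l) := by
  have hkl : (k : ℚ) - l ≠ 0 := sub_ne_zero.2 (by exact_mod_cast h)
  rw [eq_inv_smul_iff₀ hkl]
  have hk := one_sub_mul_geomSeries k
  have hl := one_sub_mul_geomSeries l
  simp only [smul_eq_C_mul, map_sub]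
  linear_combination (C (k : ℚ) * geomSeries k) * hl - (C (l : ℚ) * geomSeries l) * hk

theorem geomSeries_mul_mem_span (k : ℕ) {G : PowerSeries ℚ}
    (hG : G ∈ ratSeries) :
    geomSeries k * G ∈
      ratSeries := by
  induction hG using Submodule.span_induction with
  | zero => simp
  | add F G _ _ hF hG => rw [mul_add]; exact add_mem hF hG
  | smul r F _ hF => rw [mul_smul_comm]; exact Submodule.smul_mem _ _ hF
  | mem F hF =>
    obtain ⟨i, l, a, rfl⟩ := hF
    by_cases h : k = l
    · subst h
      exact Submodule.subset_span ⟨i, k, a + 1, by ring⟩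
    · induction a with
      | zero => exact Submodule.subset_span ⟨i, k, 1, by ring⟩
      | succ a ih =>
        -- Partial fractions.
        have : geomSeries k * (X ^ i * geomSeries l ^ (a + 1)) = ((k : ℚ) - l)⁻¹ •
            ((k : ℚ) • (geomSeries k * (X ^ i * geomSeries l ^ a))
              - (l : ℚ) • (X ^ i * geomSeries l ^ (a + 1))) := by
          have := geomSeries_mul_geomSeries h
          simp only [smul_eq_C_mul] at this ⊢
          linear_combination X ^ i * geomSeries l ^ a * this
        rw [this]
        exact Submodule.smul_mem _ _ (sub_mem (Submodule.smul_mem _ _ ih)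
          (Submodule.smul_mem _ _ (Submodule.subset_span ⟨i, l, a + 1, rfl⟩)))

theorem ratSeq_of_recurrence {f g : ℕ → ℚ} (k : ℕ) (h : ∀ n, f (n + 1) = k * f n + g n)
    (hg : g ∈ ratSeq) : f ∈ ratSeq := by
  have hmk : mk f = geomSeries k * (f 0 • (1 : PowerSeries ℚ) + X * mk g) := by
    have : (1 - C (k : ℚ) * X) * mk f = f 0 • (1 : PowerSeries ℚ) + X * mk g := by
      ext n
      rcases n with _ | n
      · simp
      · rw [sub_mul, one_mul, mul_assoc, map_sub, coeff_C_mul, coeff_succ_X_mul, map_add,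
          coeff_succ_X_mul]
        simp [h, coeff_one]
    rw [← this, ← mul_assoc, mul_comm (geomSeries k), one_sub_mul_geomSeries, one_mul]
  show mk f ∈ ratSeries
  rw [hmk]
  refine geomSeries_mul_mem_span k (add_mem (Submodule.smul_mem _ _
    (Submodule.subset_span ⟨0, 0, 0, by simp⟩)) ?_)
  have hg' : mk g ∈ ratSeries := hg
  generalize mk g = G at hg'
  induction hg' using Submodule.span_induction with
  | zero => simp
  | add F G _ _ hF hG => rw [mul_add]; exact add_mem hF hG
  | smul r F _ hF => rw [mul_smul_comm]; exact Submodule.smul_mem _ _ hF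
  | mem F hF =>
    obtain ⟨i, l, a, rfl⟩ := hF
    exact Submodule.subset_span ⟨i + 1, l, a, by ring⟩

/-- Collecting the terms with the same `k` over a common denominator. -/
theorem exists_sum_of_mem_ratSeq {f : ℕ → ℚ} (hf : f ∈ ratSeq) :
    ∃ (d : ℕ) (p : ℕ → Polynomial ℚ) (a : ℕ → ℕ),
      mk f = ∑ k ∈ Finset.range (d + 1),
        (p k : PowerSeries ℚ) * ((1 - C (k : ℚ) * X) ^ a k)⁻¹ := by
  simp only [inv_one_sub_pow]
  have hf' : mk f ∈ ratSeries := hf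
  generalize mk f = F at hf'
  -- Enlarging `d` and every exponent makes two such expressions addable.
  have enlarge : ∀ (d D : ℕ) (p : ℕ → Polynomial ℚ) (a b : ℕ → ℕ), d ≤ D →
      ∃ q : ℕ → Polynomial ℚ, ∑ k ∈ Finset.range (d + 1), (p k : PowerSeries ℚ) * geomSeries k ^ a k
        = ∑ k ∈ Finset.range (D + 1), (q k : PowerSeries ℚ) * geomSeries k ^ (a k + b k) := by
    intro d D p a b hd
    refine ⟨fun k => if k ∈ Finset.range (d + 1) then
      p k * (1 - Polynomial.C (k : ℚ) * Polynomial.X) ^ b k else 0, ?_⟩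
    rw [← Finset.sum_subset (Finset.range_mono (Nat.succ_le_succ hd))]
    · refine Finset.sum_congr rfl fun k hk => ?_
      simp only [if_pos (show k ∈ Finset.range (d + 1) from hk)]
      push_cast
      have := congrArg (· ^ b k) (one_sub_mul_geomSeries k)
      simp only [mul_pow, one_pow] at this
      rw [pow_add]
      linear_combination (-(p k : PowerSeries ℚ) * geomSeries k ^ a k) * this
    · intro k _ hk
      simp only [if_neg hk, Polynomial.coe_zero, zero_mul]
  induction hf' using Submodule.span_induction with
  | zero => exact ⟨0, 0, 0, by simp⟩
  | add F G _ _ hF hG =>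
    obtain ⟨d, p, a, rfl⟩ := hF
    obtain ⟨e, q, b, rfl⟩ := hG
    obtain ⟨p', hp'⟩ := enlarge d (max d e) p a b (le_max_left _ _)
    obtain ⟨q', hq'⟩ := enlarge e (max d e) q b a (le_max_right _ _)
    refine ⟨max d e, fun k => p' k + q' k, fun k => a k + b k, ?_⟩
    rw [hp', hq', ← Finset.sum_add_distrib]
    refine Finset.sum_congr rfl fun k _ => ?_
    rw [Polynomial.coe_add, add_mul, add_comm (b k)]
  | smul r F _ hF =>
    obtain ⟨d, p, a, rfl⟩ := hF
    refine ⟨d, fun k => Polynomial.C r * p k, a, ?_⟩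
    rw [Finset.smul_sum]
    refine Finset.sum_congr rfl fun k _ => ?_
    rw [Polynomial.coe_mul, Polynomial.coe_C, smul_eq_C_mul, mul_assoc]
  | mem F hF =>
    obtain ⟨i, l, a, rfl⟩ := hF
    refine ⟨l, fun k => if k = l then Polynomial.X ^ i else 0, fun _ => a, ?_⟩
    rw [Finset.sum_eq_single l]
    · simp
    · intro k _ hk
      simp [hk]
    · intro hl
      simp at hl

theorem exists_aeval_of_mem_expPolySeq {f : ℕ → ℚ} (hf : f ∈ expPolySeq) :
    ∃ P : MvPolynomial (Fin 2) ℚ, mk (fun n => f n / (n.factorial : ℚ))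
      = MvPolynomial.aeval ![(X : PowerSeries ℚ), exp ℚ] P := by
  have hf' : mk (fun n => f n / (n.factorial : ℚ)) ∈
    expPolyRing := hf
  rw [expPolyRing] at hf'
  have hr : ({X, exp ℚ} : Set (PowerSeries ℚ)) = Set.range ![(X : PowerSeries ℚ), exp ℚ] := by
    simp [Matrix.range_cons, Set.pair_comm]
  rw [hr, Algebra.adjoin_range_eq_range_aeval] at hf'
  obtain ⟨P, hP⟩ := hf'
  exact ⟨P, hP.symm⟩

end Series

/-! ### Counting words in deletion-closed sets -/

section Words

variable {C S : Type}

/-- A set of words is closed under deleting letters from `C`. -/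
def DeletionClosed (D : Set (List (C ⊕ S))) : Prop :=
  ∀ (u v : List (C ⊕ S)) (c : C), u ++ Sum.inl c :: v ∈ D → u ++ v ∈ D

/-- The number of letters of a word that belong to `S`. -/
def starCount (l : List (C ⊕ S)) : ℕ := l.countP Sum.isRight

/-- The words `w` for which `a w` belongs to `D`. -/
def leftQuotient (a : C ⊕ S) (D : Set (List (C ⊕ S))) : Set (List (C ⊕ S)) := {l | a :: l ∈ D}

/-- The number of words of length `n` in `D`, as a rational number. -/
noncomputable def wordCount (D : Set (List (C ⊕ S))) (n : ℕ) : ℚ :=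
  (Nat.card {w : Fin n → C ⊕ S // List.ofFn w ∈ D} : ℚ)

theorem DeletionClosed.leftQuotient {D : Set (List (C ⊕ S))} (hD : DeletionClosed D)
    (a : C ⊕ S) : DeletionClosed (leftQuotient a D) :=
  fun u v c h => hD (a :: u) v c h

theorem DeletionClosed.leftQuotient_subset {D : Set (List (C ⊕ S))} (hD : DeletionClosed D)
    (c : C) : _root_.leftQuotient (Sum.inl c) D ⊆ D :=
  fun l h => hD [] l c h

/-- A subword with the same number of letters from `S` arises by deleting letters from `C`. -/
theorem DeletionClosed.mem_of_sublist {D : Set (List (C ⊕ S))} (hD : DeletionClosed D)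
    {l l' : List (C ⊕ S)} (h : l.Sublist l') (hc : starCount l = starCount l') :
    ∀ u, u ++ l' ∈ D → u ++ l ∈ D := by
  induction h with
  | slnil => exact fun u h => h
  | @cons l₁ l₂ a h ih =>
    intro u hu
    have h1 : starCount l₁ ≤ starCount l₂ := h.countP_le
    rcases a with c | s
    · exact ih (by simpa [starCount] using hc) u (hD u l₂ c hu)
    · simp only [starCount, List.countP_cons, Sum.isRight_inr, if_true] at h1 hc
      omega
  | @cons_cons l₁ l₂ a h ih =>
    intro u hu
    have := ih (by simpa [starCount, List.countP_cons] using hc) (u ++ [a]) (by simpa using hu)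
    simpa using this

/-- By Higman's lemma, deletion-closed sets of words with boundedly many letters from `S` satisfy
the descending chain condition. -/
theorem wellFounded_deletionClosed [Finite C] [Finite S] (m : ℕ) :
    WellFounded fun D E : {D : Set (List (C ⊕ S)) // DeletionClosed D ∧ ∀ l ∈ D, starCount l < m} =>
      D.1 ⊂ E.1 := by
  have irr : IsStrictOrder {D : Set (List (C ⊕ S)) // DeletionClosed D ∧ ∀ l ∈ D, starCount l < m}
      (fun D E => D.1 ⊂ E.1) :=
    { irrefl := fun D => ssubset_irrefl D.1, trans := fun _ _ _ h h' => h.trans h' }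
  rw [RelEmbedding.wellFounded_iff_isEmpty]
  refine ⟨fun f => ?_⟩
  have hf : ∀ i j, i < j → (f j).1 ⊂ (f i).1 := fun i j h => f.map_rel_iff.2 h
  -- Words leaving the chain one by one contradict Higman's lemma, applied together with the
  -- pigeonhole principle for the number of letters from `S`.
  choose w hw hw' using fun i => Set.exists_of_ssubset (hf i (i + 1) (Nat.lt_succ_self i))
  have pre : IsPreorder (List (C ⊕ S)) (List.SublistForall₂ Eq) := {}
  have hpwo := ((Set.finite_univ (α := C ⊕ S)).partiallyWellOrderedOn (r := Eq)
    |>.partiallyWellOrderedOn_sublistForall₂).prod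
      ((Set.finite_Iio m).partiallyWellOrderedOn (r := Eq))
  obtain ⟨i, j, hij, h1, h2⟩ := hpwo.exists_lt (f := fun i => (w i, starCount (w i)))
    fun i => ⟨fun _ _ => trivial, (f i).2.2 _ (hw i)⟩
  obtain ⟨l, hl, hl'⟩ := List.sublistForall₂_iff.1 h1
  rw [List.forall₂_eq_eq_eq] at hl
  subst hl
  have hj : w j ∈ (f (i + 1)).1 := by
    rcases (Nat.succ_le_of_lt hij).eq_or_lt with h | h
    · exact h ▸ hw j
    · exact (hf _ _ h).subset (hw j)
  exact hw' i ((f (i + 1)).2.1.mem_of_sublist hl' h2 [] hj)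

theorem wordCount_succ [Fintype C] [Fintype S] (D : Set (List (C ⊕ S))) (n : ℕ) :
    wordCount D (n + 1) = ∑ a, wordCount (leftQuotient a D) n := by
  have e : {w : Fin (n + 1) → C ⊕ S // List.ofFn w ∈ D} ≃
      Σ a, {w : Fin n → C ⊕ S // List.ofFn w ∈ leftQuotient a D} :=
    ((Fin.consEquiv fun _ => C ⊕ S).symm.subtypeEquiv
      (q := fun p : (C ⊕ S) × (Fin n → C ⊕ S) => p.1 :: List.ofFn p.2 ∈ D)
      fun w => by
        rw [← Fin.cons_self_tail w]
        simp only [Fin.consEquiv, List.ofFn_cons]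
        rfl).trans
      { toFun := fun p => ⟨p.1.1, p.1.2, p.2⟩
        invFun := fun p => ⟨(p.1, p.2.1), p.2.2⟩
        left_inv := fun _ => rfl
        right_inv := fun _ => rfl }
  simp only [wordCount]
  rw [Nat.card_congr e, Nat.card_sigma]
  push_cast
  rfl

/-- The counting sequences of deletion-closed sets of words with boundedly many letters from `S`
lie in every space of sequences that is stable under solving `f (n + 1) = k f n + g n`.

Removing the first letter expresses the counting sequence of `D` through those of the quotients
`leftQuotient a D`, each of which either equals `D`, or is strictly smaller, or has fewer letters
from `S`. -/
theorem wordCount_mem [Fintype C] [Fintype S] (N : Submodule ℚ (ℕ → ℚ))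
    (hN : ∀ (f g : ℕ → ℚ) (k : ℕ), (∀ n, f (n + 1) = k * f n + g n) → g ∈ N → f ∈ N) (m : ℕ) :
    ∀ D : Set (List (C ⊕ S)), DeletionClosed D → (∀ l ∈ D, starCount l < m) →
      wordCount D ∈ N := by
  classical
  induction m with
  | zero =>
    intro D _ hm
    have : wordCount D = 0 := by
      ext n
      have : IsEmpty {w : Fin n → C ⊕ S // List.ofFn w ∈ D} :=
        ⟨fun w => absurd (hm _ w.2) (Nat.not_lt_zero _)⟩
      simp [wordCount]
    rw [this]
    exact zero_mem N
  | succ m ihm =>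
    intro D hD hm
    suffices h : ∀ D : {D : Set (List (C ⊕ S)) // DeletionClosed D ∧ ∀ l ∈ D, starCount l < m + 1},
        wordCount D.1 ∈ N from h ⟨D, hD, hm⟩
    intro D
    refine (wellFounded_deletionClosed (m + 1)).induction (C := fun D => wordCount D.1 ∈ N) D ?_
    rintro ⟨D, hD, hm⟩ ih
    -- The letters with `leftQuotient a D = D` contribute the multiple of `wordCount D n`.
    refine hN _ (∑ a with leftQuotient a D ≠ D, wordCount (leftQuotient a D))
      (Finset.card {a | leftQuotient a D = D}) (fun n => ?_) (Submodule.sum_mem _ fun a ha => ?_)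
    · rw [wordCount_succ, ← Finset.sum_filter_add_sum_filter_not _ (fun a => leftQuotient a D = D),
        Finset.sum_apply]
      congr 1
      rw [Finset.sum_congr rfl (g := fun _ => wordCount D n) fun a ha => by
        rw [(Finset.mem_filter.1 ha).2], Finset.sum_const, nsmul_eq_mul]
    · have hne := (Finset.mem_filter.1 ha).2
      rcases a with c | s
      · have hsub := hD.leftQuotient_subset c
        exact ih ⟨_, hD.leftQuotient _, fun l hl => hm l (hsub hl)⟩ (hsub.ssubset_of_ne hne)
      · refine ihm _ (hD.leftQuotient _) fun l hl => ?_
        have := hm _ hl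
        simpa [starCount, List.countP_cons] using this

end Words

/-! ### Bases extracted from ordered families, and insertion of letters -/

section Greedy

/-- Let a finite family `v` span `V`, and order its indices by an injective key. The members that
are not in the span of their predecessors form a basis of `V`. -/
theorem finrank_eq_card_notMem_span {F V I J : Type*} [Field F] [AddCommGroup V] [Module F V]
    [Finite I] [LinearOrder J] (κ : I → J) (hκ : Function.Injective κ) (v : I → V)
    (hv : Submodule.span F (Set.range v) = ⊤) :
    Module.finrank F V =
      Nat.card {i // v i ∉ Submodule.span F (v '' {j | κ j < κ i})} := by
  classical
  let _ : LinearOrder I := LinearOrder.lift' κ hκ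
  have _ : Fintype I := Fintype.ofFinite I
  have hlt : ∀ i j : I, κ j < κ i ↔ j < i := fun _ _ => Iff.rfl
  simp only [hlt]
  have hli : ∀ s : Finset I, (∀ i ∈ s, v i ∉ Submodule.span F (v '' {j | j < i})) →
      LinearIndepOn F v (s : Set I) := by
    intro s
    induction s using Finset.induction_on_max with
    | empty => intro _; simp
    | insert a s hs ih =>
      intro h
      rw [Finset.coe_insert]
      refine (ih fun i hi => h i (Finset.mem_insert_of_mem hi)).insert fun ha => ?_
      exact h a (Finset.mem_insert_self _ _)
        (Submodule.span_mono (Set.image_mono fun i hi => hs i hi) ha)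
  have hspan : ∀ i, v i ∈ Submodule.span F
      (v '' {i | v i ∉ Submodule.span F (v '' {j | j < i})}) := by
    intro i
    induction i using WellFoundedLT.induction with
    | _ i ih =>
      by_cases h : v i ∈ Submodule.span F (v '' {j | j < i})
      · refine (Submodule.span_le.2 ?_) h
        rintro _ ⟨j, hj, rfl⟩
        exact ih j hj
      · exact Submodule.subset_span ⟨i, h, rfl⟩
  have hli' := hli (Finset.univ.filter fun i => v i ∉ Submodule.span F (v '' {j | j < i}))
    fun i hi => (Finset.mem_filter.1 hi).2
  have hcoe : ((Finset.univ.filter fun i => v i ∉ Submodule.span F (v '' {j | j < i}) :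
      Finset I) : Set I) = {i | v i ∉ Submodule.span F (v '' {j | j < i})} := by ext; simp
  rw [hcoe] at hli'
  refine Module.finrank_eq_nat_card_basis (Module.Basis.mk hli' ?_)
  rw [← hv, Submodule.span_le]
  rintro _ ⟨i, rfl⟩
  have := hspan i
  rwa [Set.image_eq_range] at this

/-- Inserting the same letter at the same place is strictly monotone for the lexicographic
order. -/
theorem toLex_insertNth_lt {J : Type*} [LinearOrder J] {n : ℕ} (p : Fin (n + 1)) (c : J)
    {w w' : Fin n → J} (h : toLex w < toLex w') :
    toLex (p.insertNth (α := fun _ => J) c w) < toLex (p.insertNth (α := fun _ => J) c w') := by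
  obtain ⟨i, hi, hlt⟩ := h
  refine ⟨p.succAbove i, fun j hj => ?_, by simpa using hlt⟩
  rcases Fin.eq_self_or_eq_succAbove p j with rfl | ⟨j, rfl⟩
  · simp
  · simpa using hi j ((Fin.strictMono_succAbove p).lt_iff_lt.1 hj)

theorem exists_ofFn_insertNth {α : Type*} (u v : List α) (c : α) :
    ∃ (n : ℕ) (w : Fin n → α) (p : Fin (n + 1)), List.ofFn w = u ++ v ∧
      List.ofFn (p.insertNth (α := fun _ => α) c w) = u ++ c :: v := by
  induction u with
  | nil =>
    refine ⟨v.length, v.get, 0, by simp, ?_⟩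
    rw [Fin.insertNth_zero', List.ofFn_cons, List.ofFn_get, List.nil_append]
  | cons a u ih =>
    obtain ⟨n, w, p, h1, h2⟩ := ih
    refine ⟨n + 1, Fin.cons a w, p.succ, by rw [List.ofFn_cons, h1, List.cons_append], ?_⟩
    rw [List.cons_append, ← h2, ← List.ofFn_cons]
    congr 1
    refine (Fin.insertNth_eq_iff).2 ⟨by simp, ?_⟩
    ext i
    refine Fin.cases ?_ (fun i => ?_) i
    · simp [Fin.removeNth]
    · simp [Fin.removeNth]

end Greedy

/-! ### Standard words -/

section Count

variable {A : TwistedCommAlgebra.{u}} (M : TCModule.{u, v} A)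

/-- The bijection `Unit ⊕ Fin n ≃ Fin (n + 1)` sending the extra point to `p` and preserving the
order of the others. -/
def insertEquiv {n : ℕ} (p : Fin (n + 1)) : Unit ⊕ Fin n ≃ Fin (n + 1) :=
  (((finSuccEquiv' p).trans (Equiv.optionEquivSumPUnit _)).trans (Equiv.sumComm _ _)).symm

@[simp] theorem insertEquiv_inl {n : ℕ} (p : Fin (n + 1)) : insertEquiv p (Sum.inl ()) = p := by
  simp [insertEquiv]

@[simp] theorem insertEquiv_inr {n : ℕ} (p : Fin (n + 1)) (i : Fin n) :
    insertEquiv p (Sum.inr i) = p.succAbove i := by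
  simp [insertEquiv]

open Classical in
/-- The monomial with word `w`, or `0` if `w` is not the word of a monomial. -/
noncomputable def wordVector {C S L : Type} [Finite L] (y : C → A.obj Unit) (ι : L → S)
    (x : M.obj L) {K : Type} [Finite K] (w : K → C ⊕ S) : M.obj K :=
  if h : ∃ m, IsMonomial M y ι x K w m then h.choose else 0

variable {M}

section

variable {C S L : Type} [Finite L] {y : C → A.obj Unit} {ι : L → S} {x : M.obj L}

theorem IsMonomial.wordVector_eq (hι : Function.Injective ι) {K : Type} [Finite K]
    {w : K → C ⊕ S} {m : M.obj K} (h : IsMonomial M y ι x K w m) : wordVector M y ι x w = m := by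
  have h' : ∃ m, IsMonomial M y ι x K w m := ⟨m, h⟩
  rw [wordVector, dif_pos h']
  exact h'.choose_spec.unique hι _ h

theorem exists_isMonomial_of_wordVector_ne_zero {K : Type} [Finite K] {w : K → C ⊕ S}
    (h : wordVector M y ι x w ≠ 0) : ∃ m, IsMonomial M y ι x K w m := by
  by_contra hn
  exact h (by rw [wordVector, dif_neg hn])

/-- Inserting the colour `c` into a word acts on monomials by a linear map. -/
theorem wordVector_insertNth (hι : Function.Injective ι) {n : ℕ} (p : Fin (n + 1)) (c : C)
    (w : Fin n → C ⊕ S) :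
    wordVector M y ι x (p.insertNth (α := fun _ => C ⊕ S) (Sum.inl c) w)
      = M.map (insertEquiv p) (M.smul (y c) (wordVector M y ι x w)) := by
  by_cases h : ∃ m, IsMonomial M y ι x (Fin n) w m
  · obtain ⟨m, h⟩ := h
    rw [h.wordVector_eq hι]
    refine ((h.smul c).map_of_eq (insertEquiv p) ?_).wordVector_eq hι
    ext (⟨⟨⟩⟩ | i) <;> simp
  · have h' : ¬ ∃ m, IsMonomial M y ι x (Fin (n + 1))
        (p.insertNth (α := fun _ => C ⊕ S) (Sum.inl c) w) m := by
      rintro ⟨m, hm⟩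
      obtain ⟨m', hm', -⟩ := hm.exists_eq_map_smul (insertEquiv p) (c := c) (by simp)
      refine h ⟨m', ?_⟩
      convert hm' using 1
      ext i; simp
    rw [wordVector, dif_neg h', wordVector, dif_neg h, _root_.map_zero, _root_.map_zero]

end

theorem span_range_wordVector {C S I : Type} {L : I → Type} [∀ i, Finite (L i)]
    {y : C → A.obj Unit} {ι : ∀ i, L i → S} {x : ∀ i, M.obj (L i)}
    (hι : ∀ i, Function.Injective (ι i))
    (hspan : ∀ (K : Type) [Finite K],
      Submodule.span ℂ {m : M.obj K | ∃ i w, IsMonomial M y (ι i) (x i) K w m} = ⊤) (n : ℕ) :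
    Submodule.span ℂ (Set.range fun q : I × (Fin n → C ⊕ S) =>
      wordVector M y (ι q.1) (x q.1) q.2) = ⊤ := by
  rw [eq_top_iff, ← hspan (Fin n), Submodule.span_le]
  rintro m ⟨i, w, h⟩
  exact Submodule.subset_span ⟨(i, w), h.wordVector_eq (hι i)⟩

variable {C S I : Type} [Fintype C] [Fintype S]
  {L : I → Type} [∀ i, Finite (L i)]

/-- Words are compared first by the generator and then lexicographically; letters are compared
through an arbitrary enumeration of the alphabet. -/
noncomputable def wordKey {n : ℕ} (i : I) (w : Fin n → C ⊕ S) :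
    I ×ₗ Lex (Fin n → Fin (Fintype.card (C ⊕ S))) :=
  toLex (i, toLex (Fintype.equivFin (C ⊕ S) ∘ w))

theorem wordKey_injective {n : ℕ} :
    Function.Injective fun q : I × (Fin n → C ⊕ S) => wordKey q.1 q.2 := by
  rintro ⟨i, w⟩ ⟨i', w'⟩ h
  have h' := toLex.injective h
  rw [Prod.mk.injEq] at h'
  obtain ⟨rfl, h2⟩ := h'
  exact Prod.ext rfl ((Fintype.equivFin (C ⊕ S)).injective.comp_left (toLex.injective h2))

variable [LinearOrder I]

theorem wordKey_insertNth_lt {n : ℕ} (p : Fin (n + 1)) (c : C ⊕ S) {i i' : I}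
    {w w' : Fin n → C ⊕ S} (h : wordKey i w < wordKey i' w') :
    wordKey i (p.insertNth (α := fun _ => C ⊕ S) c w)
      < wordKey i' (p.insertNth (α := fun _ => C ⊕ S) c w') := by
  have key : ∀ w : Fin n → C ⊕ S,
      Fintype.equivFin (C ⊕ S) ∘ p.insertNth (α := fun _ => C ⊕ S) c w
        = p.insertNth (α := fun _ => Fin (Fintype.card (C ⊕ S))) (Fintype.equivFin (C ⊕ S) c)
          (Fintype.equivFin (C ⊕ S) ∘ w) := fun w => by
    refine (Fin.eq_insertNth_iff).2 ⟨by simp, ?_⟩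
    ext i; simp [Fin.removeNth]
  simp only [wordKey, key, Prod.Lex.toLex_lt_toLex] at h ⊢
  exact h.imp id fun h => ⟨h.1, toLex_insertNth_lt p _ h.2⟩

/-- The words of monomials of the generator `x i` that are not linear combinations of monomials
with smaller words. -/
def standardWords (M : TCModule.{u, v} A) (y : C → A.obj Unit) (ι : ∀ i, L i → S)
    (x : ∀ i, M.obj (L i)) (i : I) : Set (List (C ⊕ S)) :=
  {l | ∃ (n : ℕ) (w : Fin n → C ⊕ S), List.ofFn w = l ∧ wordVector M y (ι i) (x i) w ∉
    Submodule.span ℂ ((fun q : I × (Fin n → C ⊕ S) => wordVector M y (ι q.1) (x q.1) q.2) ''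
      {q | wordKey q.1 q.2 < wordKey i w})}

variable {y : C → A.obj Unit} {ι : ∀ i, L i → S} {x : ∀ i, M.obj (L i)}

theorem ofFn_mem_standardWords {i : I} {n : ℕ} {w : Fin n → C ⊕ S} :
    List.ofFn w ∈ standardWords M y ι x i ↔ wordVector M y (ι i) (x i) w ∉
      Submodule.span ℂ ((fun q : I × (Fin n → C ⊕ S) => wordVector M y (ι q.1) (x q.1) q.2) ''
        {q | wordKey q.1 q.2 < wordKey i w}) := by
  refine ⟨?_, fun h => ⟨n, w, rfl, h⟩⟩
  rintro ⟨n', w', h, h'⟩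
  rw [List.ofFn_inj'] at h
  cases h
  exact h'

/-- Inserting a colour is linear and preserves the order of words, so it preserves the words of
monomials that are combinations of smaller ones. -/
theorem deletionClosed_standardWords (hι : ∀ i, Function.Injective (ι i)) (i : I) :
    DeletionClosed (standardWords M y ι x i) := by
  intro u v c h
  obtain ⟨n, w, p, h1, h2⟩ := exists_ofFn_insertNth u v (Sum.inl c)
  rw [← h2, ofFn_mem_standardWords] at h
  rw [← h1, ofFn_mem_standardWords]
  refine fun h' => h ?_
  rw [wordVector_insertNth (hι i)]
  have := Submodule.mem_map_of_mem (f := M.map (insertEquiv p) ∘ₗ M.smul (y c)) h'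
  rw [Submodule.map_span] at this
  refine Submodule.span_mono ?_ this
  rintro _ ⟨_, ⟨⟨j, w'⟩, hlt, rfl⟩, rfl⟩
  exact ⟨(j, _), wordKey_insertNth_lt p (Sum.inl c) hlt, wordVector_insertNth (hι j) p c w'⟩

theorem starCount_lt_of_mem_standardWords (hι : ∀ i, Function.Injective (ι i)) (i : I) :
    ∀ l ∈ standardWords M y ι x i, starCount l < Fintype.card (C ⊕ S) + 1 := by
  rintro _ ⟨n, w, rfl, h⟩
  obtain ⟨m, hm⟩ := exists_isMonomial_of_wordVector_ne_zero fun h0 => h (h0 ▸ zero_mem _)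
  rw [Nat.lt_succ_iff, starCount, List.countP_eq_length_filter]
  refine List.Nodup.length_le_card ?_
  rw [List.Nodup, List.pairwise_filter, List.pairwise_ofFn]
  intro k k' hlt hk _ he
  obtain ⟨s, hs⟩ := Sum.isRight_iff.1 hk
  exact hlt.ne (hm.eq_of_label_eq (hι i) k k' s hs (he ▸ hs))

/-- The dimension of `M_n` is the number of standard words of length `n`. -/
theorem finrank_eq_sum_wordCount [Fintype I] (hι : ∀ i, Function.Injective (ι i))
    (hspan : ∀ (K : Type) [Finite K],
      Submodule.span ℂ {m : M.obj K | ∃ i w, IsMonomial M y (ι i) (x i) K w m} = ⊤) :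
    (fun n => (Module.finrank ℂ (M.obj (Fin n)) : ℚ))
      = ∑ i, wordCount (standardWords M y ι x i) := by
  ext n
  have e : {q : I × (Fin n → C ⊕ S) // wordVector M y (ι q.1) (x q.1) q.2 ∉
      Submodule.span ℂ ((fun q : I × (Fin n → C ⊕ S) => wordVector M y (ι q.1) (x q.1) q.2) ''
        {q' | wordKey q'.1 q'.2 < wordKey q.1 q.2})} ≃
      Σ i, {w : Fin n → C ⊕ S // List.ofFn w ∈ standardWords M y ι x i} :=
    { toFun := fun q => ⟨q.1.1, q.1.2, ofFn_mem_standardWords.2 q.2⟩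
      invFun := fun q => ⟨(q.1, q.2.1), ofFn_mem_standardWords.1 q.2.2⟩
      left_inv := fun _ => rfl
      right_inv := fun _ => rfl }
  rw [finrank_eq_card_notMem_span _ wordKey_injective _ (span_range_wordVector hι hspan n),
    Nat.card_congr e, Nat.card_sigma, Finset.sum_apply]
  push_cast
  rfl

end Count

/-! ### Hilbert series of finitely generated modules -/

theorem mainTheorem10 (A : TwistedCommAlgebra.{u}) (hA : A.FinitelyGeneratedInOrderOne)
    (M : TCModule.{u, v} A) (hM : M.FinitelyGenerated) :
    (∀ n : ℕ, Module.Finite ℂ (M.obj (Fin n))) ∧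
    (∃ P : MvPolynomial (Fin 2) ℚ,
      M.hilbertSeries = MvPolynomial.aeval ![(PowerSeries.X : PowerSeries ℚ), PowerSeries.exp ℚ] P) ∧
    (∃ (d : ℕ) (p : ℕ → Polynomial ℚ) (a : ℕ → ℕ),
      M.hilbertSeriesStar = ∑ k ∈ Finset.range (d + 1),
        (p k : PowerSeries ℚ) * ((1 - PowerSeries.C (k : ℚ) * PowerSeries.X) ^ a k)⁻¹) := by
  obtain ⟨s, Q, _, z, hQ, hz⟩ := hA
  obtain ⟨r, L, _, x, hx⟩ := hM
  -- Transport the generators of `A` to the one-point set `Unit`.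
  have e : ∀ c, Nonempty (Q c ≃ Unit) := fun c => by
    obtain ⟨h1, ⟨h2⟩⟩ := Nat.card_eq_one_iff_unique.1 (hQ c)
    exact ⟨⟨fun _ => (), fun _ => h2, fun _ => Subsingleton.elim _ _, fun _ => rfl⟩⟩
  let y : Fin s → A.obj Unit := fun c => A.map (e c).some (z c)
  have hy : ∀ W : (K : Type) → [Finite K] → Submodule ℂ (A.obj K),
      A.IsSubalgebra W → (∀ c, y c ∈ W Unit) → ∀ (K : Type) [Finite K], W K = ⊤ := by
    intro W hW hyW
    refine hz W hW fun c => ?_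
    have := hW.1 _ _ (e c).some.symm _ (hyW c)
    rwa [A.map_map, Equiv.self_trans_symm, A.map_refl] at this
  let _ : Fintype (Σ i, L i) := Fintype.ofFinite _
  let ι : ∀ i, L i → Σ i, L i := fun i l => ⟨i, l⟩
  have hι : ∀ i, Function.Injective (ι i) := fun i => sigma_mk_injective
  have hspan : ∀ (K : Type) [Finite K],
      Submodule.span ℂ {m : M.obj K | ∃ i w, IsMonomial M y (ι i) (x i) K w m} = ⊤ :=
    fun K _ => M.span_isMonomial y ι x hy hx K
  have hmem : ∀ N : Submodule ℚ (ℕ → ℚ), (∀ (f g : ℕ → ℚ) (k : ℕ),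
      (∀ n, f (n + 1) = k * f n + g n) → g ∈ N → f ∈ N) →
      (fun n => (Module.finrank ℂ (M.obj (Fin n)) : ℚ)) ∈ N := by
    intro N hN
    rw [finrank_eq_sum_wordCount hι hspan]
    exact Submodule.sum_mem _ fun i _ => wordCount_mem N hN _ _
      (deletionClosed_standardWords hι i) (starCount_lt_of_mem_standardWords hι i)
  refine ⟨fun n => ⟨?_⟩,
    exists_aeval_of_mem_expPolySeq (hmem _ fun _ _ k => expPolySeq_of_recurrence k),
    exists_sum_of_mem_ratSeq (hmem _ fun _ _ k => ratSeq_of_recurrence k)⟩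
  rw [← span_range_wordVector hι hspan n]
  exact Submodule.fg_span (Set.finite_range _)
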